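/- **Setting.** Let $\mathcal L$ be a first-order vocabulary (relation and function symbols, no equality symbol) containing at least one individual constant. $\mathcal L$-formulas are built from atomic formulas $R(t_1,\dots,t_k)$ with $\vee$, $\neg$, $\exists$. A formula is *provable in the sequent calculus* if the sequent $\vdash \exists x A$ (resp. the one-element sequent $\exists xA$) is derivable, with cut allowed, either in Gentzen's two-sided calculus $\mathbf{G1c}$ restricted to $\vee,\neg,\exists$, or in the one-sided calculus on multisets of formulas with axiom $\neg A, A$ and rules $$\frac{\Gamma,A_i}{\Gamma,A_1\vee A_2}\quad \frac{\Gamma,\neg A\quad \Delta,\neg B}{\Gamma,\Delta,\neg(A\vee B)}\quad \frac{\Gamma,A[t/x]}{\Gamma,\exists xA}\quad \frac{\Gamma,\neg A[\alpha/x]}{\Gamma,\neg\exists xA}\quad \frac{\Gamma,A,A}{\Gamma,A}\quad \frac{\Gamma}{\Gamma,A}\quad \frac{\Gamma,A}{\Gamma,\neg\neg A}\quad \frac{\Gamma,A\quad \Delta,\neg A}{\Gamma,\Delta}$$ where $t$ is an $\mathcal L$-term and the eigenvariable $\alpha$ does not occur free in the conclusion of its rule. **The calculus $\mathsf{QF}$.**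 Types are generated by $U ::= \iota \mid \Box \mid U\times U \mid U\to U$. Typed terms ($\mathcal L^+$-terms) are built from variables of every type (the individual variables being those of type $\iota$), the function symbols and constants of $\mathcal L$ acting on terms of type $\iota$, $\varepsilon:\Box$, pairs $(s,t)$, projections $\pi_1,\pi_2$, $\lambda$-abstraction, application, and the case operator $\mathsf{case}_A(u,v):U$ for $u,v:U$ and $A$ a proposition. Simultaneously, propositions are built from $R(t_1,\dots,t_k)$ with $t_i:\iota$ and $u_1\equiv u_2$ with $u_1,u_2$ of the same type by $\vee$ and $\neg$; $A\to B$ abbreviates $\neg A\vee B$. Convertibility is the equivalence relation generated by closing the following rewrite rules under all contexts: $(\lambda x.u)v\longrightarrow u[v/x]$, $\pi_i(u_1,u_2)\longrightarrow u_i$, $f(\mathsf{case}_A(u,v))\longrightarrow \mathsf{case}_A(fu,fv)$ for a term $f$ of function type, and $(\mathsf{case}_A(f,g))u\longrightarrow \mathsf{case}_A(fu,gu)$. The calculus $\mathsf{QF}$ derives propositions. Its axioms are all instances of propositional tautologies, $u\equiv v$ for convertible $u,v$, $A\to \mathsf{case}_A(u,v)\equiv u$ and $\neg A\to \mathsf{case}_A(u,v)\equiv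 v$; its rules are modus ponens and: from $A[u/x]$ and $u\equiv v$ infer $A[v/x]$. Write $\vdash_{\mathsf{QF}}A$ for derivability. Quantifier-free $\mathcal L$-formulas are regarded as propositions. **Theorem (Herbrand's Theorem).** Let $A$ be a quantifier-free $\mathcal L$-formula such that $\exists x A$ is a sentence (no free variables). If $\exists xA$ is provable in the sequent calculus, then there are $n\ge 1$ and closed $\mathcal L$-terms $t_1,\dots,t_n$ such that $$\vdash_{\mathsf{QF}} A[t_1/x]\vee\dots\vee A[t_n/x].$$ -/

import Mathlib

universe u v

namespace Herbrand

/-! ## First-order formulas and sequent calculus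

The basic connectives are disjunction, negation and the existential quantifier; there is no
equality symbol.  Free individual variables are named by natural numbers; bound variables are
well-scoped de Bruijn indices, so formulas are identified up to renaming of bound variables. -/

/-- `Fml L n`: formulas over `L` with `n` dangling bound variables.  `Fml L 0` is the type of
`L`-formulas; for `A : Fml L 1`, the formula `A.ex : Fml L 0` is `∃ x A`. -/
inductive Fml (L : FirstOrder.Language.{u, v}) : ℕ → Type (max u v)
  | rel {n k : ℕ} (R : L.Relations k) (ts : Fin k → L.Term (ℕ ⊕ Fin n)) : Fml L n
  | or {n : ℕ} (A B : Fml L n) : Fml L n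
  | neg {n : ℕ} (A : Fml L n) : Fml L n
  | ex {n : ℕ} (A : Fml L (n + 1)) : Fml L n

namespace Fml

variable {L : FirstOrder.Language.{u, v}}

/-- Extend a substitution for bound variables under a quantifier; the variable bound by the
quantifier has the last index. -/
def liftSubst {n m : ℕ} (σ : Fin n → L.Term (ℕ ⊕ Fin m)) : Fin (n + 1) → L.Term (ℕ ⊕ Fin (m + 1)) :=
  Fin.snoc (α := fun _ => L.Term (ℕ ⊕ Fin (m + 1)))
    (fun i => (σ i).relabel (Sum.map id Fin.castSucc))
    (.var (Sum.inr (Fin.last m)))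

/-- Simultaneous capture-free substitution of terms for the dangling bound variables. -/
def subst : {n m : ℕ} → Fml L n → (Fin n → L.Term (ℕ ⊕ Fin m)) → Fml L m
  | _, _, rel R ts, σ =>
      rel R (fun i => (ts i).subst (Sum.elim (fun a => .var (Sum.inl a)) σ))
  | _, _, or A B, σ => or (A.subst σ) (B.subst σ)
  | _, _, neg A, σ => neg (A.subst σ)
  | _, _, ex A, σ => ex (A.subst (liftSubst σ))

/-- `A.inst t` is `A[t/x]`, where `x` is the dangling bound variable of `A`. -/
def inst (A : Fml L 1) (t : L.Term ℕ) : Fml L 0 :=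
  A.subst (fun _ => t.relabel Sum.inl)

/-- The set of free individual variables. -/
def freeVars : {n : ℕ} → Fml L n → Set ℕ
  | _, rel _ ts => {a | ∃ i, Sum.inl a ∈ (ts i).varFinset}
  | _, or A B => A.freeVars ∪ B.freeVars
  | _, neg A => A.freeVars
  | _, ex A => A.freeVars

/-- Quantifier-free formulas. -/
def IsQF : {n : ℕ} → Fml L n → Prop
  | _, rel _ _ => True
  | _, or A B => A.IsQF ∧ B.IsQF
  | _, neg A => A.IsQF
  | _, ex _ => False

theorem IsQF.subst : {n m : ℕ} → {A : Fml L n} → A.IsQF → (σ : Fin n → L.Term (ℕ ⊕ Fin m)) →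
    (A.subst σ).IsQF
  | _, _, .rel _ _, _, _ => trivial
  | _, _, .or _ _, h, σ => ⟨IsQF.subst h.1 σ, IsQF.subst h.2 σ⟩
  | _, _, .neg A, h, σ => IsQF.subst (A := A) h σ
  | _, _, .ex _, h, _ => h.elim

theorem IsQF.inst {A : Fml L 1} (h : A.IsQF) (t : L.Term ℕ) : (A.inst t).IsQF :=
  h.subst _

end Fml

/-- Provability of the two-sided sequent `Γ ⊢ Δ` in Gentzen's calculus **G1c**, restricted to the
connectives `∨`, `¬`, `∃`. -/
inductive G1c {L : FirstOrder.Language.{u, v}} : Multiset (Fml L 0) → Multiset (Fml L 0) → Prop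
  | id (A : Fml L 0) : G1c {A} {A}
  | orR₁ {Γ Δ} (A B : Fml L 0) : G1c Γ (A ::ₘ Δ) → G1c Γ (A.or B ::ₘ Δ)
  | orR₂ {Γ Δ} (A B : Fml L 0) : G1c Γ (B ::ₘ Δ) → G1c Γ (A.or B ::ₘ Δ)
  | orL {Γ Δ} (A B : Fml L 0) : G1c (A ::ₘ Γ) Δ → G1c (B ::ₘ Γ) Δ → G1c (A.or B ::ₘ Γ) Δ
  | negR {Γ Δ} (A : Fml L 0) : G1c (A ::ₘ Γ) Δ → G1c Γ (A.neg ::ₘ Δ)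
  | negL {Γ Δ} (A : Fml L 0) : G1c Γ (A ::ₘ Δ) → G1c (A.neg ::ₘ Γ) Δ
  | exR {Γ Δ} (A : Fml L 1) (t : L.Term ℕ) : G1c Γ (A.inst t ::ₘ Δ) → G1c Γ (A.ex ::ₘ Δ)
  | exL {Γ Δ} (A : Fml L 1) (a : ℕ) (hA : a ∉ A.ex.freeVars) (hΓ : ∀ C ∈ Γ, a ∉ C.freeVars)
      (hΔ : ∀ C ∈ Δ, a ∉ C.freeVars) :
      G1c (A.inst (.var a) ::ₘ Γ) Δ → G1c (A.ex ::ₘ Γ) Δ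
  | cR {Γ Δ} (A : Fml L 0) : G1c Γ (A ::ₘ A ::ₘ Δ) → G1c Γ (A ::ₘ Δ)
  | cL {Γ Δ} (A : Fml L 0) : G1c (A ::ₘ A ::ₘ Γ) Δ → G1c (A ::ₘ Γ) Δ
  | wR {Γ Δ} (A : Fml L 0) : G1c Γ Δ → G1c Γ (A ::ₘ Δ)
  | wL {Γ Δ} (A : Fml L 0) : G1c Γ Δ → G1c (A ::ₘ Γ) Δ
  | cut {Γ₁ Γ₂ Δ₁ Δ₂} (A : Fml L 0) : G1c Γ₁ (A ::ₘ Δ₁) → G1c (A ::ₘ Γ₂) Δ₂ →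
      G1c (Γ₁ + Γ₂) (Δ₁ + Δ₂)

/-- Provability of the sequent `Γ` in the one-sided calculus with explicit negation. -/
inductive OneSided {L : FirstOrder.Language.{u, v}} : Multiset (Fml L 0) → Prop
  | lem (A : Fml L 0) : OneSided {A.neg, A}
  | or₁ {Γ} (A B : Fml L 0) : OneSided (A ::ₘ Γ) → OneSided (A.or B ::ₘ Γ)
  | or₂ {Γ} (A B : Fml L 0) : OneSided (B ::ₘ Γ) → OneSided (A.or B ::ₘ Γ)
  | negOr {Γ Δ} (A B : Fml L 0) : OneSided (A.neg ::ₘ Γ) → OneSided (B.neg ::ₘ Δ) →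
      OneSided ((A.or B).neg ::ₘ (Γ + Δ))
  | ex {Γ} (A : Fml L 1) (t : L.Term ℕ) : OneSided (A.inst t ::ₘ Γ) → OneSided (A.ex ::ₘ Γ)
  | negEx {Γ} (A : Fml L 1) (a : ℕ) (hA : a ∉ A.ex.neg.freeVars) (hΓ : ∀ C ∈ Γ, a ∉ C.freeVars) :
      OneSided ((A.inst (.var a)).neg ::ₘ Γ) → OneSided (A.ex.neg ::ₘ Γ)
  | c {Γ} (A : Fml L 0) : OneSided (A ::ₘ A ::ₘ Γ) → OneSided (A ::ₘ Γ)
  | w {Γ} (A : Fml L 0) : OneSided Γ → OneSided (A ::ₘ Γ)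
  | negNeg {Γ} (A : Fml L 0) : OneSided (A ::ₘ Γ) → OneSided (A.neg.neg ::ₘ Γ)
  | cut {Γ Δ} (A : Fml L 0) : OneSided (A ::ₘ Γ) → OneSided (A.neg ::ₘ Δ) → OneSided (Γ + Δ)

/-! ## Types, terms and propositions of the type theory -/

/-- Types: individuals `ι`, the null type `□`, products and function types. -/
inductive Ty : Type
  | ind : Ty
  | null : Ty
  | prod (U V : Ty) : Ty
  | arr (U V : Ty) : Ty

/-- `BVar Γ U`: the positions (de Bruijn indices) of type `U` in a list `Γ` of types. -/
inductive BVar : List Ty → Ty → Type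
  | zero {Γ : List Ty} {U : Ty} : BVar (U :: Γ) U
  | succ {Γ : List Ty} {U V : Ty} (x : BVar Γ U) : BVar (V :: Γ) U

mutual

/-- `Tm L Γ U`: well-typed `L⁺`-terms of type `U` whose dangling bound variables are listed in
`Γ`.  `Tm L [] U` is the type of `L⁺`-terms of type `U`.  Free variables are named: for every type
`U` there are the variables `fvar U i`, `i : ℕ`; the individual variable `i` is `fvar ι i`.
`lam` binds the variable at the head of the list, and `cond A s t` is the case distinction
operator with parameter the proposition `A`. -/
inductive Tm (L : FirstOrder.Language.{u, v}) : List Ty → Ty → Type (max u v)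
  | fvar {Γ : List Ty} (U : Ty) (i : ℕ) : Tm L Γ U
  | bvar {Γ : List Ty} {U : Ty} (x : BVar Γ U) : Tm L Γ U
  | func {Γ : List Ty} {k : ℕ} (f : L.Functions k) (ts : Fin k → Tm L Γ Ty.ind) : Tm L Γ Ty.ind
  | eps {Γ : List Ty} : Tm L Γ Ty.null
  | pair {Γ : List Ty} {U V : Ty} (s : Tm L Γ U) (t : Tm L Γ V) : Tm L Γ (Ty.prod U V)
  | fst {Γ : List Ty} {U V : Ty} (s : Tm L Γ (Ty.prod U V)) : Tm L Γ U
  | snd {Γ : List Ty} {U V : Ty} (s : Tm L Γ (Ty.prod U V)) : Tm L Γ V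
  | lam {Γ : List Ty} {U V : Ty} (t : Tm L (U :: Γ) V) : Tm L Γ (Ty.arr U V)
  | app {Γ : List Ty} {U V : Ty} (s : Tm L Γ (Ty.arr U V)) (t : Tm L Γ U) : Tm L Γ V
  | cond {Γ : List Ty} {U : Ty} (A : Prp L Γ) (s t : Tm L Γ U) : Tm L Γ U

/-- `Prp L Γ`: propositions whose dangling bound variables are listed in `Γ`.  `Prp L []` is the
set `Prop` of well-formed propositions of the type theory. -/
inductive Prp (L : FirstOrder.Language.{u, v}) : List Ty → Type (max u v)
  | or {Γ : List Ty} (A B : Prp L Γ) : Prp L Γ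
  | neg {Γ : List Ty} (A : Prp L Γ) : Prp L Γ
  | rel {Γ : List Ty} {k : ℕ} (R : L.Relations k) (ts : Fin k → Tm L Γ Ty.ind) : Prp L Γ
  | eqv {Γ : List Ty} {U : Ty} (s t : Tm L Γ U) : Prp L Γ

end

section Substitution

variable {L : FirstOrder.Language.{u, v}}

/-- Extend a renaming of bound variables under a binder. -/
def liftRen {Γ Δ : List Ty} (ρ : ∀ U, BVar Γ U → BVar Δ U) (W : Ty) :
    ∀ U, BVar (W :: Γ) U → BVar (W :: Δ) U
  | _, BVar.zero => BVar.zero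
  | _, BVar.succ x => BVar.succ (ρ _ x)

mutual

/-- Renaming of dangling bound variables in a term. -/
def Tm.ren : {Γ Δ : List Ty} → {U : Ty} → (∀ U, BVar Γ U → BVar Δ U) → Tm L Γ U → Tm L Δ U
  | _, _, _, _, .fvar U i => .fvar U i
  | _, _, _, ρ, .bvar x => .bvar (ρ _ x)
  | _, _, _, ρ, .func f ts => .func f (fun i => (ts i).ren ρ)
  | _, _, _, _, .eps => .eps
  | _, _, _, ρ, .pair s t => .pair (s.ren ρ) (t.ren ρ)
  | _, _, _, ρ, .fst s => .fst (s.ren ρ)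
  | _, _, _, ρ, .snd s => .snd (s.ren ρ)
  | _, _, _, ρ, .lam t => .lam (t.ren (liftRen ρ _))
  | _, _, _, ρ, .app s t => .app (s.ren ρ) (t.ren ρ)
  | _, _, _, ρ, .cond A s t => .cond (A.ren ρ) (s.ren ρ) (t.ren ρ)

/-- Renaming of dangling bound variables in a proposition. -/
def Prp.ren : {Γ Δ : List Ty} → (∀ U, BVar Γ U → BVar Δ U) → Prp L Γ → Prp L Δ
  | _, _, ρ, .or A B => .or (A.ren ρ) (B.ren ρ)
  | _, _, ρ, .neg A => .neg (A.ren ρ)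
  | _, _, ρ, .rel R ts => .rel R (fun i => (ts i).ren ρ)
  | _, _, ρ, .eqv s t => .eqv (s.ren ρ) (t.ren ρ)

end

/-- Extend a substitution for bound variables under a binder. -/
def liftSub {Γ Δ : List Ty} (σ : ∀ U, BVar Γ U → Tm L Δ U) (W : Ty) :
    ∀ U, BVar (W :: Γ) U → Tm L (W :: Δ) U
  | _, BVar.zero => .bvar BVar.zero
  | _, BVar.succ x => (σ _ x).ren (fun _ => BVar.succ)

mutual

/-- Simultaneous capture-free substitution for the dangling bound variables of a term. -/
def Tm.sub : {Γ Δ : List Ty} → {U : Ty} → (∀ U, BVar Γ U → Tm L Δ U) → Tm L Γ U → Tm L Δ U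
  | _, _, _, _, .fvar U i => .fvar U i
  | _, _, _, σ, .bvar x => σ _ x
  | _, _, _, σ, .func f ts => .func f (fun i => (ts i).sub σ)
  | _, _, _, _, .eps => .eps
  | _, _, _, σ, .pair s t => .pair (s.sub σ) (t.sub σ)
  | _, _, _, σ, .fst s => .fst (s.sub σ)
  | _, _, _, σ, .snd s => .snd (s.sub σ)
  | _, _, _, σ, .lam t => .lam (t.sub (liftSub σ _))
  | _, _, _, σ, .app s t => .app (s.sub σ) (t.sub σ)
  | _, _, _, σ, .cond A s t => .cond (A.sub σ) (s.sub σ) (t.sub σ)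

/-- Simultaneous capture-free substitution for the dangling bound variables of a proposition. -/
def Prp.sub : {Γ Δ : List Ty} → (∀ U, BVar Γ U → Tm L Δ U) → Prp L Γ → Prp L Δ
  | _, _, σ, .or A B => .or (A.sub σ) (B.sub σ)
  | _, _, σ, .neg A => .neg (A.sub σ)
  | _, _, σ, .rel R ts => .rel R (fun i => (ts i).sub σ)
  | _, _, σ, .eqv s t => .eqv (s.sub σ) (t.sub σ)

end

/-- The substitution replacing the head variable by `t` and fixing the others. -/
def single {Γ : List Ty} {W : Ty} (t : Tm L Γ W) : ∀ U, BVar (W :: Γ) U → Tm L Γ U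
  | _, BVar.zero => t
  | _, BVar.succ x => .bvar x

/-- `s[t/x]`, where `x` is the head variable. -/
def Tm.inst {Γ : List Ty} {W U : Ty} (s : Tm L (W :: Γ) U) (t : Tm L Γ W) : Tm L Γ U :=
  s.sub (single t)

/-- `A[t/x]`, where `x` is the head variable. -/
def Prp.inst {Γ : List Ty} {W : Ty} (A : Prp L (W :: Γ)) (t : Tm L Γ W) : Prp L Γ :=
  A.sub (single t)

end Substitution

/-! ## Reduction and conversion -/

mutual

/-- One-step reduction of terms: the five rewrite rules, closed under all contexts. -/
inductive Tm.Red {L : FirstOrder.Language.{u, v}} : {Γ : List Ty} → {U : Ty} → Tm L Γ U → Tm L Γ U → Prop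
  | beta {Γ U V} (s : Tm L (U :: Γ) V) (t : Tm L Γ U) : Tm.Red (.app (.lam s) t) (s.inst t)
  | fst_pair {Γ U V} (s : Tm L Γ U) (t : Tm L Γ V) : Tm.Red (.fst (.pair s t)) s
  | snd_pair {Γ U V} (s : Tm L Γ U) (t : Tm L Γ V) : Tm.Red (.snd (.pair s t)) t
  | app_cond {Γ U V} (f : Tm L Γ (Ty.arr U V)) (A : Prp L Γ) (s t : Tm L Γ U) :
      Tm.Red (.app f (.cond A s t)) (.cond A (.app f s) (.app f t))
  | cond_app {Γ U V} (A : Prp L Γ) (f g : Tm L Γ (Ty.arr U V)) (s : Tm L Γ U) :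
      Tm.Red (.app (.cond A f g) s) (.cond A (.app f s) (.app g s))
  | func {Γ} {k : ℕ} (f : L.Functions k) (ts : Fin k → Tm L Γ Ty.ind) (i : Fin k)
      (t : Tm L Γ Ty.ind) : Tm.Red (ts i) t → Tm.Red (.func f ts) (.func f (Function.update ts i t))
  | pair_left {Γ U V} {s s' : Tm L Γ U} (t : Tm L Γ V) :
      Tm.Red s s' → Tm.Red (.pair s t) (.pair s' t)
  | pair_right {Γ U V} (s : Tm L Γ U) {t t' : Tm L Γ V} :
      Tm.Red t t' → Tm.Red (.pair s t) (.pair s t')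
  | fst {Γ U V} {s s' : Tm L Γ (Ty.prod U V)} : Tm.Red s s' → Tm.Red (.fst s) (.fst s')
  | snd {Γ U V} {s s' : Tm L Γ (Ty.prod U V)} : Tm.Red s s' → Tm.Red (.snd s) (.snd s')
  | lam {Γ U V} {s s' : Tm L (U :: Γ) V} : Tm.Red s s' → Tm.Red (.lam s) (.lam s')
  | app_left {Γ U V} {s s' : Tm L Γ (Ty.arr U V)} (t : Tm L Γ U) :
      Tm.Red s s' → Tm.Red (.app s t) (.app s' t)
  | app_right {Γ U V} (s : Tm L Γ (Ty.arr U V)) {t t' : Tm L Γ U} :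
      Tm.Red t t' → Tm.Red (.app s t) (.app s t')
  | cond_prp {Γ U} {A A' : Prp L Γ} (s t : Tm L Γ U) :
      Prp.Red A A' → Tm.Red (.cond A s t) (.cond A' s t)
  | cond_left {Γ U} (A : Prp L Γ) {s s' : Tm L Γ U} (t : Tm L Γ U) :
      Tm.Red s s' → Tm.Red (.cond A s t) (.cond A s' t)
  | cond_right {Γ U} (A : Prp L Γ) (s : Tm L Γ U) {t t' : Tm L Γ U} :
      Tm.Red t t' → Tm.Red (.cond A s t) (.cond A s t')

/-- One-step reduction of a term occurring in a proposition. -/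
inductive Prp.Red {L : FirstOrder.Language.{u, v}} : {Γ : List Ty} → Prp L Γ → Prp L Γ → Prop
  | or_left {Γ} {A A' : Prp L Γ} (B : Prp L Γ) : Prp.Red A A' → Prp.Red (.or A B) (.or A' B)
  | or_right {Γ} (A : Prp L Γ) {B B' : Prp L Γ} : Prp.Red B B' → Prp.Red (.or A B) (.or A B')
  | neg {Γ} {A A' : Prp L Γ} : Prp.Red A A' → Prp.Red (.neg A) (.neg A')
  | rel {Γ} {k : ℕ} (R : L.Relations k) (ts : Fin k → Tm L Γ Ty.ind) (i : Fin k)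
      (t : Tm L Γ Ty.ind) : Tm.Red (ts i) t → Prp.Red (.rel R ts) (.rel R (Function.update ts i t))
  | eqv_left {Γ U} {s s' : Tm L Γ U} (t : Tm L Γ U) : Tm.Red s s' → Prp.Red (.eqv s t) (.eqv s' t)
  | eqv_right {Γ U} (s : Tm L Γ U) {t t' : Tm L Γ U} : Tm.Red t t' → Prp.Red (.eqv s t) (.eqv s t')

end

/-- Convertibility: the equivalence relation generated by one-step reduction. -/
def Tm.Conv {L : FirstOrder.Language.{u, v}} {Γ : List Ty} {U : Ty} (s t : Tm L Γ U) : Prop :=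
  Relation.EqvGen Tm.Red s t

/-! ## The quantifier-free calculus -/

section Calculus

variable {L : FirstOrder.Language.{u, v}}

/-- Implication as the usual abbreviation. -/
def Prp.imp {Γ : List Ty} (A B : Prp L Γ) : Prp L Γ := .or (.neg A) B

/-- `p 0 ∨ ⋯ ∨ p n`. -/
def Prp.disj {Γ : List Ty} : {n : ℕ} → (Fin (n + 1) → Prp L Γ) → Prp L Γ
  | 0, p => p 0
  | _ + 1, p => .or (Prp.disj (fun i => p i.castSucc)) (p (Fin.last _))

/-- Instances of propositional tautologies: propositions that hold under every assignment of truth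
values that respects the propositional connectives (and is otherwise arbitrary). -/
def Prp.IsTautology (A : Prp L []) : Prop :=
  ∀ w : Prp L [] → Prop, (∀ B C, w (.or B C) ↔ (w B ∨ w C)) → (∀ B, w (.neg B) ↔ ¬ w B) → w A

/-- `QF A`: the proposition `A` is provable in the quantifier-free calculus. -/
inductive QF : Prp L [] → Prop
  | taut {A : Prp L []} : A.IsTautology → QF A
  | conv {U : Ty} {s t : Tm L [] U} : s.Conv t → QF (.eqv s t)
  | cond_pos {U : Ty} (A : Prp L []) (s t : Tm L [] U) : QF (A.imp (.eqv (.cond A s t) s))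
  | cond_neg {U : Ty} (A : Prp L []) (s t : Tm L [] U) :
      QF ((Prp.neg A).imp (.eqv (.cond A s t) t))
  | subst {U : Ty} (A : Prp L [U]) (s t : Tm L [] U) :
      QF (A.inst s) → QF (.eqv s t) → QF (A.inst t)
  | mp {A B : Prp L []} : QF A → QF (A.imp B) → QF B

/-- `L`-terms as `L⁺`-terms of type `ι`. -/
def toTm : L.Term (ℕ ⊕ Fin 0) → Tm L [] Ty.ind
  | .var (.inl a) => .fvar Ty.ind a
  | .var (.inr i) => i.elim0
  | .func f ts => .func f (fun i => toTm (ts i))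

/-- Quantifier-free `L`-formulas as propositions. -/
def Fml.toPrp : (A : Fml L 0) → A.IsQF → Prp L []
  | .rel R ts, _ => .rel R (fun i => toTm (ts i))
  | .or A B, h => .or (A.toPrp h.1) (B.toPrp h.2)
  | .neg A, h => .neg (A.toPrp h)
  | .ex _, h => h.elim

end Calculus

end Herbrand

-- The argument is semantic and needs no cut elimination. Let `w` be a truth assignment to
-- propositions that respects the connectives. The closed terms form a structure in which an atomic
-- relation holds when `w` says so (`herbrandStructure`). By soundness, cut included, `∃ x A` is
-- true there; its witness is an element of the domain, hence a closed term `t`, and `w` makes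
-- `A[t/x]` true (`exists_closed_instance`). So every assignment satisfies some closed instance of
-- `A`.
--
-- Assignments form a closed, hence compact, subset of a power of `Bool`, and each instance is true
-- on an open set. Finitely many instances therefore suffice, and their disjunction is a tautology
-- (`exists_disj_isTautology`). Tautologies are axioms of `QF`, so no other axiom or rule of that
-- calculus is used.

namespace Herbrand

open FirstOrder FirstOrder.Language

/-! ## Tarskian semantics of formulas -/

section Semantics

variable {L : FirstOrder.Language.{u, v}} {M : Type*} [L.Structure M]

/-- Truth of a formula in an `L`-structure under an assignment of the free variables and of the
dangling bound variables. -/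
def Fml.Realize : {n : ℕ} → Fml L n → (ℕ → M) → (Fin n → M) → Prop
  | _, .rel R ts, e, x => Structure.RelMap R (fun i => (ts i).realize (Sum.elim e x))
  | _, .or A B, e, x => A.Realize e x ∨ B.Realize e x
  | _, .neg A, e, x => ¬ A.Realize e x
  | _, .ex A, e, x => ∃ m : M, A.Realize e (Fin.snoc (α := fun _ => M) x m)

theorem exists_mem_cons_iff {α : Type*} {a : α} {s : Multiset α} {p : α → Prop} :
    (∃ b ∈ a ::ₘ s, p b) ↔ p a ∨ ∃ b ∈ s, p b := by
  simp only [Multiset.mem_cons, or_and_right, exists_or, exists_eq_left]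

theorem realize_congr_of_mem_varFinset {α : Type*} [DecidableEq α] (t : L.Term α) {e e' : α → M}
    (h : ∀ a ∈ t.varFinset, e a = e' a) : t.realize e = t.realize e' := by
  induction t with
  | var a => exact h a (by simp [Term.varFinset])
  | func f ts ih =>
    refine congrArg (Structure.funMap f) (funext fun i => ih i fun a ha => h a ?_)
    simp only [Term.varFinset, Finset.mem_biUnion, Finset.mem_univ, true_and]
    exact ⟨i, ha⟩

theorem Fml.realize_congr {n : ℕ} (A : Fml L n) {e e' : ℕ → M} (x : Fin n → M)
    (h : ∀ a ∈ A.freeVars, e a = e' a) : A.Realize e x ↔ A.Realize e' x := by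
  induction A with
  | rel R ts =>
    refine iff_of_eq (congrArg (Structure.RelMap R)
      (funext fun i => realize_congr_of_mem_varFinset _ ?_))
    rintro (a | j) ha
    · exact h a ⟨i, ha⟩
    · rfl
  | or A B ihA ihB =>
    exact or_congr (ihA x fun a ha => h a (.inl ha)) (ihB x fun a ha => h a (.inr ha))
  | neg A ih => exact not_congr (ih x h)
  | ex A ih => exact exists_congr fun m => ih _ h

theorem Fml.realize_subst {n m : ℕ} (A : Fml L n) (σ : Fin n → L.Term (ℕ ⊕ Fin m)) (e : ℕ → M)
    (x : Fin m → M) :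
    (A.subst σ).Realize e x ↔ A.Realize e (fun i => (σ i).realize (Sum.elim e x)) := by
  induction A generalizing m with
  | rel R ts =>
    refine iff_of_eq (congrArg (Structure.RelMap R) (funext fun i => ?_))
    rw [Term.realize_subst]
    congr 1
    ext (a | j) <;> rfl
  | or A B ihA ihB => exact or_congr (ihA σ x) (ihB σ x)
  | neg A ih => exact not_congr (ih σ x)
  | ex A ih =>
    refine exists_congr fun b => (ih _ _).trans (iff_of_eq (congrArg (A.Realize e) ?_))
    ext i
    refine Fin.lastCases ?_ (fun j => ?_) i
    · simp [liftSubst]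
    · simp only [liftSubst, Fin.snoc_castSucc, Term.realize_relabel]
      congr 1
      ext (a | j) <;> simp

theorem Fml.realize_inst (A : Fml L 1) (t : L.Term ℕ) (e : ℕ → M) (x : Fin 0 → M) :
    (A.inst t).Realize e x ↔ A.Realize e (Fin.snoc (α := fun _ => M) x (t.realize e)) := by
  refine (Fml.realize_subst ..).trans (iff_of_eq (congrArg (A.Realize e) ?_))
  ext i
  rw [Subsingleton.elim i (Fin.last 0), Fin.snoc_last, Term.realize_relabel]
  rfl

theorem Fml.realize_ex_of_inst {A : Fml L 1} {t : L.Term ℕ} {e : ℕ → M} {x : Fin 0 → M}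
    (h : (A.inst t).Realize e x) : A.ex.Realize e x :=
  ⟨_, (Fml.realize_inst ..).1 h⟩

/-- The semantic content of the eigenvariable condition: a variable not free in `A` can be
reassigned freely, so it can stand for any candidate witness. -/
theorem Fml.realize_inst_update {A : Fml L 1} {a : ℕ} (ha : a ∉ A.freeVars) (e : ℕ → M)
    (x : Fin 0 → M) (m : M) :
    (A.inst (.var a)).Realize (Function.update e a m) x ↔
      A.Realize e (Fin.snoc (α := fun _ => M) x m) := by
  rw [Fml.realize_inst, Term.realize_var, Function.update_self]
  exact Fml.realize_congr _ _ fun b hb =>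
    Function.update_of_ne (ne_of_mem_of_not_mem hb ha) _ _

theorem Fml.realize_update {C : Fml L 0} {a : ℕ} (ha : a ∉ C.freeVars) (e : ℕ → M)
    (x : Fin 0 → M) (m : M) : C.Realize (Function.update e a m) x ↔ C.Realize e x :=
  Fml.realize_congr _ _ fun _ hb => Function.update_of_ne (ne_of_mem_of_not_mem hb ha) _ _

/-! ## Soundness of the sequent calculi -/

/-- A sequent is read as a disjunction. The assignment `e` must vary in the induction, because the
eigenvariable rule uses its premise at an updated assignment. -/
theorem OneSided.sound {Γ : Multiset (Fml L 0)} (h : OneSided Γ) (x : Fin 0 → M) (e : ℕ → M) :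
    ∃ C ∈ Γ, C.Realize e x := by
  induction h generalizing e with
  | lem A =>
    by_cases hA : A.Realize e x
    · exact ⟨A, by simp, hA⟩
    · exact ⟨A.neg, by simp, hA⟩
  | or₁ A B _ ih =>
    have := ih e
    simp only [exists_mem_cons_iff] at this ⊢
    exact this.imp_left Or.inl
  | or₂ A B _ ih =>
    have := ih e
    simp only [exists_mem_cons_iff] at this ⊢
    exact this.imp_left Or.inr
  | negOr A B _ _ ih₁ ih₂ =>
    have h₁ := ih₁ e
    have h₂ := ih₂ e
    simp only [exists_mem_cons_iff, Multiset.mem_add, Fml.Realize] at h₁ h₂ ⊢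
    grind
  | ex A t _ ih =>
    have := ih e
    simp only [exists_mem_cons_iff] at this ⊢
    exact this.imp_left Fml.realize_ex_of_inst
  | @negEx Γ A a hA hΓ _ ih =>
    rw [exists_mem_cons_iff]
    refine or_iff_not_imp_right.2 fun hn => ?_
    rintro ⟨m, hm⟩
    -- Sending the eigenvariable to the supposed witness `m` refutes the principal formula of the
    -- premise and leaves the side formulas, all false under `e`, unchanged.
    have := ih (Function.update e a m)
    rw [exists_mem_cons_iff] at this
    rcases this with h | ⟨C, hC, h⟩
    · exact h ((Fml.realize_inst_update hA e x m).2 hm)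
    · exact hn ⟨C, hC, (Fml.realize_update (hΓ C hC) e x m).1 h⟩
  | c A _ ih =>
    have := ih e
    simp only [exists_mem_cons_iff] at this ⊢
    tauto
  | w A _ ih =>
    rw [exists_mem_cons_iff]
    exact .inr (ih e)
  | negNeg A _ ih =>
    have := ih e
    simp only [exists_mem_cons_iff] at this ⊢
    exact this.imp_left fun h hn => hn h
  | cut A _ _ ih₁ ih₂ =>
    have h₁ := ih₁ e
    have h₂ := ih₂ e
    simp only [exists_mem_cons_iff, Multiset.mem_add, Fml.Realize] at h₁ h₂ ⊢
    grind

theorem G1c.sound {Γ Δ : Multiset (Fml L 0)} (h : G1c Γ Δ) (x : Fin 0 → M) (e : ℕ → M)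
    (hΓ : ∀ C ∈ Γ, C.Realize e x) : ∃ D ∈ Δ, D.Realize e x := by
  induction h generalizing e with
  | id A => exact ⟨A, by simp, hΓ A (by simp)⟩
  | orR₁ A B _ ih =>
    have := ih e hΓ
    simp only [exists_mem_cons_iff] at this ⊢
    exact this.imp_left Or.inl
  | orR₂ A B _ ih =>
    have := ih e hΓ
    simp only [exists_mem_cons_iff] at this ⊢
    exact this.imp_left Or.inr
  | orL A B _ _ ih₁ ih₂ =>
    rw [Multiset.forall_mem_cons] at hΓ
    rcases hΓ.1 with h | h
    · exact ih₁ e (Multiset.forall_mem_cons.2 ⟨h, hΓ.2⟩)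
    · exact ih₂ e (Multiset.forall_mem_cons.2 ⟨h, hΓ.2⟩)
  | negR A _ ih =>
    rw [exists_mem_cons_iff]
    refine or_iff_not_imp_right.2 fun hn hA => ?_
    exact hn (ih e (Multiset.forall_mem_cons.2 ⟨hA, hΓ⟩))
  | negL A _ ih =>
    rw [Multiset.forall_mem_cons] at hΓ
    have := ih e hΓ.2
    rw [exists_mem_cons_iff] at this
    exact this.resolve_left hΓ.1
  | exR A t _ ih =>
    have := ih e hΓ
    simp only [exists_mem_cons_iff] at this ⊢
    exact this.imp_left Fml.realize_ex_of_inst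
  | exL A a hA hΓ' hΔ _ ih =>
    rw [Multiset.forall_mem_cons] at hΓ
    obtain ⟨m, hm⟩ := hΓ.1
    -- The eigenvariable is assigned the witness `m`; freshness transports truth of the side
    -- formulas between the two assignments, in both directions.
    obtain ⟨D, hD, h⟩ := ih (Function.update e a m) (Multiset.forall_mem_cons.2
      ⟨(Fml.realize_inst_update hA e x m).2 hm,
        fun C hC => (Fml.realize_update (hΓ' C hC) e x m).2 (hΓ.2 C hC)⟩)
    exact ⟨D, hD, (Fml.realize_update (hΔ D hD) e x m).1 h⟩
  | cR A _ ih =>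
    have := ih e hΓ
    simp only [exists_mem_cons_iff] at this ⊢
    tauto
  | cL A _ ih => exact ih e (Multiset.forall_mem_cons.2 ⟨(Multiset.forall_mem_cons.1 hΓ).1, hΓ⟩)
  | wR A _ ih =>
    rw [exists_mem_cons_iff]
    exact .inr (ih e hΓ)
  | wL A _ ih => exact ih e (Multiset.forall_mem_cons.1 hΓ).2
  | cut A _ _ ih₁ ih₂ =>
    have h₁ := ih₁ e fun C hC => hΓ C (Multiset.mem_add.2 (.inl hC))
    rw [exists_mem_cons_iff] at h₁
    rcases h₁ with h | ⟨D, hD, h⟩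
    · obtain ⟨D, hD, h'⟩ := ih₂ e
        (Multiset.forall_mem_cons.2 ⟨h, fun C hC => hΓ C (Multiset.mem_add.2 (.inr hC))⟩)
      exact ⟨D, Multiset.mem_add.2 (.inr hD), h'⟩
    · exact ⟨D, Multiset.mem_add.2 (.inl hD), h⟩

end Semantics

/-! ## Herbrand models -/

section HerbrandModel

variable {L : FirstOrder.Language.{u, v}}

/-- The embedding of closed terms into the terms that occur in formulas. -/
def closedTerm {n : ℕ} (t : L.Term Empty) : L.Term (ℕ ⊕ Fin n) :=
  t.relabel Empty.elim

/-- The structure on the closed terms in which the relations hold as a truth assignment for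
propositions prescribes. -/
@[reducible]
def herbrandStructure (w : Prp L [] → Prop) : L.Structure (L.Term Empty) where
  funMap f ts := .func f ts
  RelMap R ts := w (.rel R fun i => toTm (closedTerm (ts i)))

/-- In a term model evaluation is substitution. Named variables are excluded because substitution
keeps them while evaluation replaces them by values of `e`. -/
theorem subst_closedTerm_eq_realize (w : Prp L [] → Prop) {n : ℕ} (t : L.Term (ℕ ⊕ Fin n))
    (ht : ∀ a, Sum.inl a ∉ t.varFinset) (e : ℕ → L.Term Empty) (x : Fin n → L.Term Empty) :
    t.subst (Sum.elim (fun a => .var (Sum.inl a)) fun i => closedTerm (n := 0) (x i)) =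
      closedTerm (@Term.realize L _ (herbrandStructure w) _ (Sum.elim e x) t) := by
  induction t with
  | var a =>
    rcases a with a | i
    · exact absurd (by simp [Term.varFinset]) (ht a)
    · rfl
  | func f ts ih =>
    refine congrArg (Term.func f) (funext fun i => ih i fun a ha => ht a ?_)
    simp only [Term.varFinset, Finset.mem_biUnion, Finset.mem_univ, true_and]
    exact ⟨i, ha⟩

/-- A truth assignment that respects the propositional connectives. -/
def IsAssignment (w : Prp L [] → Prop) : Prop :=
  (∀ B C, w (.or B C) ↔ (w B ∨ w C)) ∧ ∀ B, w (.neg B) ↔ ¬ w B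

/-- The truth lemma: atoms agree by the definition of the structure, connectives because `w`
respects them. -/
theorem realize_herbrandStructure_iff {w : Prp L [] → Prop} (hw : IsAssignment w) {n : ℕ}
    (A : Fml L n) (hA : A.IsQF) (hfree : A.freeVars = ∅) (e : ℕ → L.Term Empty)
    (x : Fin n → L.Term Empty) :
    @Fml.Realize L _ (herbrandStructure w) n A e x ↔
      w ((A.subst fun i => closedTerm (x i)).toPrp (hA.subst _)) := by
  induction A with
  | rel R ts =>
    simp only [Fml.Realize, Fml.subst, Fml.toPrp]
    refine iff_of_eq (congrArg (fun us => w (.rel R us)) (funext fun i => congrArg toTm ?_))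
    refine (subst_closedTerm_eq_realize w (ts i) (fun a ha => ?_) e x).symm
    exact (Set.eq_empty_iff_forall_notMem.1 hfree a) ⟨i, ha⟩
  | or A B ihA ihB =>
    have hf := Set.union_empty_iff.1 hfree
    simp only [Fml.Realize, Fml.subst, Fml.toPrp, hw.1]
    exact or_congr (ihA hA.1 hf.1 x) (ihB hA.2 hf.2 x)
  | neg A ih =>
    simp only [Fml.Realize, Fml.subst, Fml.toPrp, hw.2]
    exact not_congr (ih hA hfree x)
  | ex A _ => exact hA.elim

theorem exists_closed_instance {w : Prp L [] → Prop} (hw : IsAssignment w) [Nonempty L.Constants]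
    (A : Fml L 1) (hqf : A.IsQF) (hclosed : A.ex.freeVars = ∅)
    (hprov : OneSided {A.ex} ∨ G1c 0 {A.ex}) :
    ∃ t : L.Term Empty, w ((A.inst (t.relabel Empty.elim)).toPrp (hqf.inst _)) := by
  let _ := herbrandStructure w
  obtain ⟨c⟩ := ‹Nonempty L.Constants›
  -- Soundness needs some assignment of the free variables; its values are immaterial since `∃ x A`
  -- is closed.
  let e : ℕ → L.Term Empty := fun _ => Constants.term c
  have h : ∃ D ∈ ({A.ex} : Multiset (Fml L 0)), D.Realize e Fin.elim0 :=
    hprov.elim (fun h => h.sound _ e) fun h => h.sound _ e (by simp)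
  simp only [Multiset.mem_singleton, exists_eq_left] at h
  obtain ⟨t, ht⟩ := h
  refine ⟨t, ?_⟩
  have key := (realize_herbrandStructure_iff hw A hqf hclosed e _).1 ht
  have heq : (A.subst fun i => closedTerm (Fin.snoc (α := fun _ => L.Term Empty) Fin.elim0 t i)) =
      A.inst (t.relabel Empty.elim) := by
    refine congrArg A.subst (funext fun i => ?_)
    rw [Subsingleton.elim i (Fin.last 0), Fin.snoc_last, closedTerm, Term.relabel_relabel]
    congr 1
    ext a
    exact a.elim
  simpa only [heq] using key

end HerbrandModel

/-! ## Propositional compactness -/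

section Compactness

variable {L : FirstOrder.Language.{u, v}}

theorem IsAssignment.disj_iff {w : Prp L [] → Prop} (hw : IsAssignment w) {n : ℕ}
    (p : Fin (n + 1) → Prp L []) : w (Prp.disj p) ↔ ∃ i, w (p i) := by
  induction n with
  | zero => exact ⟨fun h => ⟨0, h⟩, fun ⟨i, h⟩ => by rwa [Fin.fin_one_eq_zero i] at h⟩
  | succ n ih => exact (hw.1 _ _).trans ((or_congr_left (ih _)).trans (Fin.exists_fin_succ' (P := fun i => w (p i))).symm)

/-- Each condition on an assignment equates continuous functions of finitely many coordinates.
Values are taken in `Bool` so that the product topology is compact. -/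
theorem isClosed_setOf_isAssignment :
    IsClosed {w : Prp L [] → Bool | IsAssignment fun B => w B = true} := by
  simp only [IsAssignment, Set.ofPred_and, Set.ofPred_forall]
  refine .inter (isClosed_iInter fun B => isClosed_iInter fun C => ?_) (isClosed_iInter fun B => ?_)
  · have : IsClosed {w : Prp L [] → Bool | w (.or B C) = (w B || w C)} :=
      isClosed_eq (continuous_apply _)
        ((continuous_of_discreteTopology (f := fun b : Bool × Bool => b.1 || b.2)).comp'
          (f := fun w : Prp L [] → Bool => (w B, w C)) (by fun_prop))
    convert this using 4
    rw [Bool.eq_iff_iff (b := _ || _), Bool.or_eq_true]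
  · have : IsClosed {w : Prp L [] → Bool | w (.neg B) = !(w B)} :=
      isClosed_eq (continuous_apply _)
        ((continuous_of_discreteTopology (f := fun b : Bool => !b)).comp' (continuous_apply B))
    convert this using 4
    rw [Bool.eq_iff_iff]
    simp

/-- If every truth assignment satisfies a member of a family of propositions, then a finite
disjunction of members is a tautology. -/
theorem exists_disj_isTautology {ι : Type*} [Nonempty ι] (p : ι → Prp L [])
    (h : ∀ w : Prp L [] → Prop, IsAssignment w → ∃ i, w (p i)) :
    ∃ (n : ℕ) (f : Fin (n + 1) → ι), (Prp.disj fun i => p (f i)).IsTautology := by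
  classical
  obtain ⟨s, hs⟩ := isClosed_setOf_isAssignment.isCompact.elim_finite_subcover
    (fun i => {w : Prp L [] → Bool | w (p i) = true})
    (fun i => (isOpen_discrete {true}).preimage (continuous_apply (A := fun _ => Bool) (p i)))
    (fun w hw => by simpa using h _ (Set.mem_ofPred_eq ▸ hw))
  obtain ⟨i₀⟩ := ‹Nonempty ι›
  -- The finite subcover may be empty; the extra entry `i₀` keeps the disjunction nonempty.
  let f : Fin (s.toList.length + 1) → ι := Fin.snoc (α := fun _ => ι) s.toList.get i₀
  refine ⟨_, f, fun w hor hneg => (IsAssignment.disj_iff ⟨hor, hneg⟩ _).2 ?_⟩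
  have hmem := hs (show (fun B => decide (w B)) ∈ _ by
    simp only [Set.mem_ofPred_eq, decide_eq_true_eq]
    exact ⟨hor, hneg⟩)
  simp only [Set.mem_iUnion, Set.mem_ofPred_eq, decide_eq_true_eq] at hmem
  obtain ⟨i, hi, hwi⟩ := hmem
  obtain ⟨k, hk⟩ := List.get_of_mem (Finset.mem_toList.2 hi)
  refine ⟨k.castSucc, ?_⟩
  simpa only [f, Fin.snoc_castSucc, hk] using hwi

end Compactness

end Herbrand

theorem mainTheorem2 (L : FirstOrder.Language.{u, v}) [Nonempty L.Constants]
    (A : Herbrand.Fml L 1) (hqf : A.IsQF) (hclosed : A.ex.freeVars = ∅)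
    (hprov : Herbrand.OneSided {A.ex} ∨ Herbrand.G1c 0 {A.ex}) :
    ∃ (n : ℕ) (t : Fin (n + 1) → L.Term Empty),
      Herbrand.QF (Herbrand.Prp.disj fun i =>
        (A.inst ((t i).relabel Empty.elim)).toPrp (hqf.inst ((t i).relabel Empty.elim))) := by
  -- A constant is a closed term, which supplies the padding entry of the disjunction.
  have : Nonempty (L.Term Empty) := ‹Nonempty L.Constants›.map FirstOrder.Language.Constants.term
  obtain ⟨n, t, ht⟩ := Herbrand.exists_disj_isTautology
    (fun t : L.Term Empty => (A.inst (t.relabel Empty.elim)).toPrp (hqf.inst _))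
    fun w hw => Herbrand.exists_closed_instance hw A hqf hclosed hprov
  exact ⟨n, t, .taut ht⟩
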